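/- A \emph{robot} is a nonempty, bounded, convex set $\mathbb S\subset\mathbb R^2$ with $\mathbb S=-\mathbb S$; for $Z\in\mathbb R^2$ let $\mathbb S[Z]=Z+\mathbb S$. The \emph{reach} of a set $S\subset\mathbb R^2$ is $r_S(\theta)=\sup\{x\cos\theta+y\sin\theta:(x,y)\in S\}$. Fix two robots $\mathbb A,\mathbb B$. The \emph{separation} of $\mathbb A[A]$ from $\mathbb B[B]$ in direction $\theta$ is $r_{\mathbb A[A]}(\theta)-r_{\mathbb B[B]}(\theta)-2r_{\mathbb A}(\theta)$. The configuration $(\mathbb A[A],\mathbb B[B])$ is \emph{viable} if its separation is non-negative in some direction (for robots with nonempty interior: if the interiors of $\mathbb A[A]$ and $\mathbb B[B]$ are disjoint; contact is allowed), and a direction that maximizes its separation is called an \emph{orientation} of it. A \emph{motion} from $Z_0$ to $Z_1$ is a continuous rectifiable curve $\xi:[0,1]\to\mathbb R^2$ with $\xi(0)=Z_0$, $\xi(1)=Z_1$; $\ell(\xi)$ is its arc length, and $\widehat{\xi}$ is the closed curve bounding the convex hull of its trace $\xi([0,1])$ (if the hull is a segment, that segment run through back and forth). The motion is \emph{convex}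 if $\ell(\widehat{\xi})=\ell(\xi)+|Z_0Z_1|$. A \emph{co-motion} from $(\mathbb A[A_0],\mathbb B[B_0])$ to $(\mathbb A[A_1],\mathbb B[B_1])$ is a pair $m=(\xi_{\mathbb A},\xi_{\mathbb B})$ of motions, from $A_0$ to $A_1$ and from $B_0$ to $B_1$; $\ell(m)=\ell(\xi_{\mathbb A})+\ell(\xi_{\mathbb B})$. It is \emph{collision-free} if $(\mathbb A[\xi_{\mathbb A}(t)],\mathbb B[\xi_{\mathbb B}(t)])$ is viable for all $t\in[0,1]$, and \emph{convex} if $\xi_{\mathbb A}$ and $\xi_{\mathbb B}$ are convex. Let $I_m$ be the set of all orientations of the configurations $(\mathbb A[\xi_{\mathbb A}(t)],\mathbb B[\xi_{\mathbb B}(t)])$, $t\in[0,1]$. Let $\theta_0$ be an orientation of the initial and $\theta_1$ an orientation of the goal configuration, and let $[\theta_0,\theta_1]$ be the closed arc of directions from $\theta_0$ counter-clockwise to $\theta_1$ (a single direction if $\theta_0=\theta_1$). The co-motion $m$ is \emph{net counter-clockwise} if $[\theta_0,\theta_1]\subseteq I_m$. The pair $(\widehat{\xi_{\mathbb A}},\widehat{\xi_{\mathbb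 B}})$ is \emph{counter-clockwise tight} if for every direction $\theta$, with $s(\theta)=r_{\overline{A_0A_1}}(\theta)+r_{\overline{B_0B_1}}(\pi+\theta)$, \[ r_{\widehat{\xi_{\mathbb A}}}(\theta)+r_{\widehat{\xi_{\mathbb B}}}(\pi+\theta)= \begin{cases}\max\bigl(s(\theta),\,r_{\mathbb A+\mathbb B}(\theta)\bigr)&\text{if }\theta\in[\theta_0,\theta_1],\\ s(\theta)&\text{otherwise,}\end{cases} \] where $\mathbb A+\mathbb B$ is the Minkowski sum. \textbf{Lemma.} Let $m=(\xi_{\mathbb A},\xi_{\mathbb B})$ be a collision-free co-motion from $(\mathbb A[A_0],\mathbb B[B_0])$ to $(\mathbb A[A_1],\mathbb B[B_1])$. If $m$ is net counter-clockwise and convex, and the pair $(\widehat{\xi_{\mathbb A}},\widehat{\xi_{\mathbb B}})$ is counter-clockwise tight, then $m$ is counter-clockwise optimal: $\ell(m)\le\ell(m')$ for every collision-free net counter-clockwise co-motion $m'$ from $(\mathbb A[A_0],\mathbb B[B_0])$ to $(\mathbb A[A_1],\mathbb B[B_1])$. -/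

import Mathlib

open scoped Pointwise

/-- The Euclidean plane. -/
abbrev Plane : Type := EuclideanSpace ℝ (Fin 2)

/-- The scalar product of `p` with the unit vector `(cos θ, sin θ)`. -/
noncomputable def dirCoord (θ : ℝ) (p : Plane) : ℝ :=
  p 0 * Real.cos θ + p 1 * Real.sin θ

/-- The reach `r_S(θ) = sup { x cos θ + y sin θ : (x, y) ∈ S }`. -/
noncomputable def reach (S : Set Plane) (θ : ℝ) : ℝ :=
  sSup (dirCoord θ '' S)

/-- A CCS robot (in standard placement): a nonempty, bounded, convex and centrally-symmetric
region of the plane.  It may be open, closed, or neither. -/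
structure IsCCSRobot (S : Set Plane) : Prop where
  nonempty : S.Nonempty
  bounded : Bornology.IsBounded S
  convex : Convex ℝ S
  symmetric : ∀ p ∈ S, -p ∈ S

/-- The placement of the robot `S` at position `Z`. -/
def placement (S : Set Plane) (Z : Plane) : Set Plane := Z +ᵥ S

/-- The separation of `𝔸[P]` from `𝔹[Q]` in direction `θ`. -/
noncomputable def separation (𝔸 𝔹 : Set Plane) (P Q : Plane) (θ : ℝ) : ℝ :=
  reach (placement 𝔸 P) θ - reach (placement 𝔹 Q) θ - 2 * reach 𝔸 θ

/-- The configuration `(𝔸[P], 𝔹[Q])` is viable: the separation is non-negative in some direction.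
Robots in contact are viable.  See `viable_iff_disjoint_interior` and
`viable_iff_disjoint` for the equivalence with disjointness. -/
def Viable (𝔸 𝔹 : Set Plane) (P Q : Plane) : Prop :=
  ∃ θ : ℝ, 0 ≤ separation 𝔸 𝔹 P Q θ

/-- `θ` is an orientation of `(𝔸[P], 𝔹[Q])`: a direction that maximizes the separation. (It is
unique modulo `2π` unless `P - Q` is a corner of the boundary of `𝔸 + 𝔹`, in which case every
outward normal direction at that corner is an orientation.) -/
def IsOrientation (𝔸 𝔹 : Set Plane) (P Q : Plane) (θ : ℝ) : Prop :=
  ∀ φ : ℝ, separation 𝔸 𝔹 P Q φ ≤ separation 𝔸 𝔹 P Q θ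

/-- The closed arc `[θ₀, θ₁]` of the circle of directions, from `θ₀` counter-clockwise to `θ₁`,
as a `2π`-periodic set of real angles.  It is the single direction `θ₀` if `θ₀ ≡ θ₁` mod `2π`. -/
noncomputable def ccwArc (θ₀ θ₁ : ℝ) : Set ℝ :=
  {θ | toIcoMod Real.two_pi_pos 0 (θ - θ₀) ≤ toIcoMod Real.two_pi_pos 0 (θ₁ - θ₀)}

/-- The length of a curve: the supremum of the lengths of its inscribed polygonal lines. -/
noncomputable def curveLength {P Q : Plane} (γ : Path P Q) : ENNReal :=
  eVariationOn γ Set.univ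

/-- A motion from `Z₀` to `Z₁`: a continuous rectifiable curve on `[0, 1]`. -/
structure Motion (Z₀ Z₁ : Plane) where
  path : Path Z₀ Z₁
  rectifiable : curveLength path ≠ ⊤

namespace Motion

variable {Z₀ Z₁ : Plane}

/-- The length of a motion. -/
noncomputable def length (ξ : Motion Z₀ Z₁) : ENNReal := curveLength ξ.path

/-- The trace of a motion. -/
def trace (ξ : Motion Z₀ Z₁) : Set Plane := Set.range ξ.path

/-- The boundary of the convex hull of the trace, as a point set. -/
def hullBoundary (ξ : Motion Z₀ Z₁) : Set Plane := frontier (convexHull ℝ ξ.trace)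

end Motion

/-- The closed curve `γ` runs exactly once, counter-clockwise, around the boundary of the compact
convex set `K`: there is a line of support at `γ t`, with outward normal direction `ν t`, that
turns continuously and monotonically through exactly one full turn, and while the line stands
still `γ` only moves forward along it.  If `K` is a segment, `γ` runs along it back and forth, so
its length is twice that of the segment. -/
def TraversesBoundary (K : Set Plane) {P : Plane} (γ : Path P P) : Prop :=
  ∃ ν : unitInterval → ℝ, Continuous ν ∧ Monotone ν ∧ ν 1 = ν 0 + 2 * Real.pi ∧
    (∀ t, γ t ∈ K ∧ ∀ x ∈ K, dirCoord (ν t) x ≤ dirCoord (ν t) (γ t)) ∧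
    (∀ s t, s ≤ t → ν s = ν t →
      dirCoord (ν t + Real.pi / 2) (γ s) ≤ dirCoord (ν t + Real.pi / 2) (γ t))

/-- A motion is convex if the length of the closed curve bounding the convex hull of its trace
equals the length of the motion plus the distance between its endpoints. -/
def Motion.IsConvex {Z₀ Z₁ : Plane} (ξ : Motion Z₀ Z₁) : Prop :=
  ∃ (P : Plane) (γ : Path P P), TraversesBoundary (convexHull ℝ ξ.trace) γ ∧
    curveLength γ = ξ.length + edist Z₀ Z₁

/-- A co-motion from the configuration with positions `(A₀, B₀)` to the one with positions
`(A₁, B₁)`. -/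
structure CoMotion (A₀ B₀ A₁ B₁ : Plane) where
  motionA : Motion A₀ A₁
  motionB : Motion B₀ B₁

namespace CoMotion

variable {A₀ B₀ A₁ B₁ : Plane}

/-- The length of a co-motion. -/
noncomputable def length (m : CoMotion A₀ B₀ A₁ B₁) : ENNReal :=
  m.motionA.length + m.motionB.length

/-- Every configuration along the co-motion is viable. -/
def CollisionFree (𝔸 𝔹 : Set Plane) (m : CoMotion A₀ B₀ A₁ B₁) : Prop :=
  ∀ t, Viable 𝔸 𝔹 (m.motionA.path t) (m.motionB.path t)

/-- Both motions are convex. -/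
def IsConvex (m : CoMotion A₀ B₀ A₁ B₁) : Prop :=
  m.motionA.IsConvex ∧ m.motionB.IsConvex

/-- The range `I_m` of orientations realized along the co-motion. -/
def orientationRange (𝔸 𝔹 : Set Plane) (m : CoMotion A₀ B₀ A₁ B₁) : Set ℝ :=
  {θ | ∃ t, IsOrientation 𝔸 𝔹 (m.motionA.path t) (m.motionB.path t) θ}

/-- Net counter-clockwise: `[θ₀, θ₁] ⊆ I_m`, where `θ₀` and `θ₁` are the orientations of the initial
and the goal configuration. -/
def NetCcw (𝔸 𝔹 : Set Plane) (θ₀ θ₁ : ℝ) (m : CoMotion A₀ B₀ A₁ B₁) : Prop :=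
  ccwArc θ₀ θ₁ ⊆ m.orientationRange 𝔸 𝔹

/-- `r_{A₀A₁}(θ) + r_{B₀B₁}(π + θ)`, for the segments `A₀A₁` and `B₀B₁`. -/
noncomputable def segmentReach (A₀ B₀ A₁ B₁ : Plane) (θ : ℝ) : ℝ :=
  reach (segment ℝ A₀ A₁) θ + reach (segment ℝ B₀ B₁) (Real.pi + θ)

/-- The pair of hull boundaries is counter-clockwise tight: the sum of the reach of the first in
direction `θ` and of the second in direction `π + θ` is the maximum of the reach sum of the two
segments and, only for `θ ∈ [θ₀, θ₁]`, the reach of `𝔸 + 𝔹`. -/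
def CcwTight (𝔸 𝔹 : Set Plane) (θ₀ θ₁ : ℝ) (m : CoMotion A₀ B₀ A₁ B₁) : Prop :=
  (∀ θ ∈ ccwArc θ₀ θ₁,
    reach m.motionA.hullBoundary θ + reach m.motionB.hullBoundary (Real.pi + θ) =
      max (segmentReach A₀ B₀ A₁ B₁ θ) (reach (𝔸 + 𝔹) θ)) ∧
  (∀ θ ∉ ccwArc θ₀ θ₁,
    reach m.motionA.hullBoundary θ + reach m.motionB.hullBoundary (Real.pi + θ) =
      segmentReach A₀ B₀ A₁ B₁ θ)

/-- `m` is counter-clockwise optimal: it is a shortest one among the collision-free net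
counter-clockwise co-motions between the same two configurations. -/
def IsCcwOptimal (𝔸 𝔹 : Set Plane) (θ₀ θ₁ : ℝ) (m : CoMotion A₀ B₀ A₁ B₁) : Prop :=
  m.CollisionFree 𝔸 𝔹 ∧ m.NetCcw 𝔸 𝔹 θ₀ θ₁ ∧
    ∀ m' : CoMotion A₀ B₀ A₁ B₁, m'.CollisionFree 𝔸 𝔹 → m'.NetCcw 𝔸 𝔹 θ₀ θ₁ →
      m.length ≤ m'.length

end CoMotion

theorem dirCoord_add (θ : ℝ) (p q : Plane) :
    dirCoord θ (p + q) = dirCoord θ p + dirCoord θ q := by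
  simp [dirCoord]; ring

theorem dirCoord_neg (θ : ℝ) (p : Plane) : dirCoord θ (-p) = -dirCoord θ p := by
  simp [dirCoord]; ring

theorem bddAbove_dirCoord {S : Set Plane} (hS : Bornology.IsBounded S) (θ : ℝ) :
    BddAbove (dirCoord θ '' S) := by
  obtain ⟨R, hR⟩ := hS.exists_norm_le
  refine ⟨R + R, ?_⟩
  rintro _ ⟨p, hp, rfl⟩
  have h0 : |p 0| ≤ R := (PiLp.norm_apply_le p 0).trans (hR p hp)
  have h1 : |p 1| ≤ R := (PiLp.norm_apply_le p 1).trans (hR p hp)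
  have e0 : p 0 * Real.cos θ ≤ R := by
    refine (le_abs_self _).trans ?_
    rw [abs_mul]
    exact (mul_le_of_le_one_right (abs_nonneg _) (Real.abs_cos_le_one θ)).trans h0
  have e1 : p 1 * Real.sin θ ≤ R := by
    refine (le_abs_self _).trans ?_
    rw [abs_mul]
    exact (mul_le_of_le_one_right (abs_nonneg _) (Real.abs_sin_le_one θ)).trans h1
  exact add_le_add e0 e1

theorem mem_placement {S : Set Plane} {Z x : Plane} :
    x ∈ placement S Z ↔ x - Z ∈ S := by
  rw [placement, Set.mem_vadd_set_iff_neg_vadd_mem, vadd_eq_add, neg_add_eq_sub]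

theorem reach_placement {S : Set Plane} (hS : IsCCSRobot S) (Z : Plane) (θ : ℝ) :
    reach (placement S Z) θ = dirCoord θ Z + reach S θ := by
  unfold reach
  have hb := bddAbove_dirCoord hS.bounded θ
  have hn : (dirCoord θ '' S).Nonempty := hS.nonempty.image _
  apply IsLUB.csSup_eq
  · constructor
    · rintro _ ⟨x, hx, rfl⟩
      have := le_csSup hb ⟨_, mem_placement.1 hx, rfl⟩
      have e : dirCoord θ x = dirCoord θ Z + dirCoord θ (x - Z) := by
        rw [← dirCoord_add]; congr 1; abel
      linarith
    · intro b hb'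
      have : sSup (dirCoord θ '' S) ≤ b - dirCoord θ Z := by
        refine csSup_le hn ?_
        rintro _ ⟨x, hx, rfl⟩
        have h1 := hb' ⟨Z + x, mem_placement.2 (by simpa using hx), rfl⟩
        rw [dirCoord_add] at h1
        linarith
      linarith
  · obtain ⟨x, hx⟩ := hS.nonempty
    exact ⟨_, Z + x, mem_placement.2 (by simpa using hx), rfl⟩

/-- For robots with nonempty interior, viable means that the interiors of the placements are
disjoint. -/
theorem viable_iff_disjoint_interior {𝔸 𝔹 : Set Plane} (hA : IsCCSRobot 𝔸) (hB : IsCCSRobot 𝔹)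
    (iA : (interior 𝔸).Nonempty) (iB : (interior 𝔹).Nonempty) (P Q : Plane) :
    Viable 𝔸 𝔹 P Q ↔
      Disjoint (interior (placement 𝔸 P)) (interior (placement 𝔹 Q)) := by
  have hsep : ∀ θ, separation 𝔸 𝔹 P Q θ =
      (dirCoord θ P - reach 𝔸 θ) - (dirCoord θ Q + reach 𝔹 θ) := by
    intro θ
    rw [separation, reach_placement hA, reach_placement hB]; ring
  constructor
  · rintro ⟨θ, hθ⟩
    rw [hsep] at hθ
    rw [Set.disjoint_left]
    intro x hxA hxB
    have h1 : dirCoord θ x ≤ dirCoord θ Q + reach 𝔹 θ := by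
      have := le_csSup (bddAbove_dirCoord hB.bounded θ)
        ⟨_, mem_placement.1 (interior_subset hxB), rfl⟩
      have e : dirCoord θ x = dirCoord θ Q + dirCoord θ (x - Q) := by
        rw [← dirCoord_add]; congr 1; abel
      rw [reach]; linarith
    let u : Plane := !₂[Real.cos θ, Real.sin θ]
    have hu : dirCoord θ u = 1 := by
      simp [dirCoord, u]
      nlinarith [Real.sin_sq_add_cos_sq θ]
    have hev : ∀ᶠ ε : ℝ in nhds 0, x + ε • (-u) ∈ placement 𝔸 P := by
      have hc : Filter.Tendsto (fun ε : ℝ => x + ε • (-u)) (nhds 0) (nhds x) := by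
        have : Continuous (fun ε : ℝ => x + ε • (-u)) := by fun_prop
        simpa using this.tendsto 0
      exact hc (mem_interior_iff_mem_nhds.1 hxA)
    obtain ⟨ε, hε, hε'⟩ := ((hev.filter_mono nhdsWithin_le_nhds).and
      (self_mem_nhdsWithin (s := Set.Ioi (0 : ℝ)))).exists
    have hs : dirCoord θ (ε • (-u)) = -ε := by
      have : dirCoord θ (ε • (-u)) = -ε * dirCoord θ u := by simp [dirCoord]; ring
      rw [this, hu]; ring
    have h2 : dirCoord θ P - reach 𝔸 θ ≤ dirCoord θ x - ε := by
      have := le_csSup (bddAbove_dirCoord hA.bounded θ)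
        ⟨_, hA.symmetric _ (mem_placement.1 hε), rfl⟩
      have e : dirCoord θ x - ε = dirCoord θ P - dirCoord θ (-(x + ε • (-u) - P)) := by
        rw [sub_eq_add_neg (x + ε • (-u)) P, dirCoord_neg, dirCoord_add, dirCoord_add, dirCoord_neg,
          hs]
        ring
      rw [reach]; linarith
    have : (0 : ℝ) < ε := hε'
    linarith
  · intro hd
    have hvA : interior (placement 𝔸 P) = P +ᵥ interior 𝔸 := interior_vadd P 𝔸
    have hvB : interior (placement 𝔹 Q) = Q +ᵥ interior 𝔹 := interior_vadd Q 𝔹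
    have cA : Convex ℝ (placement 𝔸 P) := hA.convex.vadd P
    have cB : Convex ℝ (placement 𝔹 Q) := hB.convex.vadd Q
    have nA : (interior (placement 𝔸 P)).Nonempty := by rw [hvA]; exact iA.vadd_set
    have nB : (interior (placement 𝔹 Q)).Nonempty := by rw [hvB]; exact iB.vadd_set
    obtain ⟨f, c, hfB, hfA⟩ := geometric_hahn_banach_open_open cB.interior isOpen_interior
      cA.interior isOpen_interior hd.symm
    have hfB' : ∀ x ∈ placement 𝔹 Q, f x ≤ c := by
      intro x hx
      have hcl : closure (interior (placement 𝔹 Q)) ⊆ {x | f x ≤ c} :=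
        closure_minimal (fun y hy => (hfB y hy).le) (isClosed_le f.continuous continuous_const)
      rw [cB.closure_interior_eq_closure_of_nonempty_interior nB] at hcl
      exact hcl (subset_closure hx)
    have hfA' : ∀ x ∈ placement 𝔸 P, c ≤ f x := by
      intro x hx
      have hcl : closure (interior (placement 𝔸 P)) ⊆ {x | c ≤ f x} :=
        closure_minimal (fun y hy => (hfA y hy).le) (isClosed_le continuous_const f.continuous)
      rw [cA.closure_interior_eq_closure_of_nonempty_interior nA] at hcl
      exact hcl (subset_closure hx)
    set a : ℝ := f (EuclideanSpace.single 0 1)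
    set b : ℝ := f (EuclideanSpace.single 1 1)
    have hf : ∀ x : Plane, f x = x 0 * a + x 1 * b := by
      intro x
      have : x = x 0 • EuclideanSpace.single 0 (1 : ℝ) + x 1 • EuclideanSpace.single 1 (1 : ℝ) := by
        ext i; fin_cases i <;> simp
      conv_lhs => rw [this]
      simp [a, b]
    let z : ℂ := ⟨a, b⟩
    have hz : z ≠ 0 := by
      intro h
      have h0 : a = 0 := congrArg Complex.re h
      have h1 : b = 0 := congrArg Complex.im h
      obtain ⟨x, hx⟩ := nA
      obtain ⟨y, hy⟩ := nB
      have hx' := hfA x hx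
      have hy' := hfB y hy
      rw [hf, h0, h1] at hx' hy'
      linarith
    have hzp : 0 < ‖z‖ := norm_pos_iff.2 hz
    have hf' : ∀ x : Plane, f x = ‖z‖ * dirCoord z.arg x := by
      intro x
      have h1 : ‖z‖ * Real.cos z.arg = a := Complex.norm_mul_cos_arg z
      have h2 : ‖z‖ * Real.sin z.arg = b := Complex.norm_mul_sin_arg z
      rw [hf, dirCoord, ← h1, ← h2]; ring
    refine ⟨z.arg, ?_⟩
    rw [hsep]
    have k1 : dirCoord z.arg Q + reach 𝔹 z.arg ≤ c / ‖z‖ := by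
      rw [← reach_placement hB]
      refine csSup_le ((nB.mono interior_subset).image _) ?_
      rintro _ ⟨x, hx, rfl⟩
      rw [le_div_iff₀ hzp, mul_comm, ← hf']
      exact hfB' x hx
    have k2 : reach 𝔸 z.arg ≤ dirCoord z.arg P - c / ‖z‖ := by
      refine csSup_le (hA.nonempty.image _) ?_
      rintro _ ⟨x, hx, rfl⟩
      have h3 := hfA' (P + -x) (mem_placement.2 (by simpa using hA.symmetric x hx))
      rw [hf', mul_comm, ← div_le_iff₀ hzp, dirCoord_add, dirCoord_neg] at h3
      linarith
    linarith

/-- For open robots, viable means that the placements are disjoint. -/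
theorem viable_iff_disjoint {𝔸 𝔹 : Set Plane} (hA : IsCCSRobot 𝔸) (hB : IsCCSRobot 𝔹)
    (oA : IsOpen 𝔸) (oB : IsOpen 𝔹) (P Q : Plane) :
    Viable 𝔸 𝔹 P Q ↔ Disjoint (placement 𝔸 P) (placement 𝔹 Q) := by
  have h := viable_iff_disjoint_interior hA hB (by rw [oA.interior_eq]; exact hA.nonempty)
    (by rw [oB.interior_eq]; exact hB.nonempty) P Q
  have e1 : interior (placement 𝔸 P) = placement 𝔸 P := (oA.vadd P).interior_eq
  have e2 : interior (placement 𝔹 Q) = placement 𝔹 Q := (oB.vadd Q).interior_eq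
  rwa [e1, e2] at h

/-! By Cauchy's formula, the perimeter of a planar convex body is the integral of its reach over a
full turn. A path closed up by the segment between its endpoints is at least as long as the boundary
of its convex hull, and convex motions are the case of equality. Hence the length of any co-motion
plus `|A₀A₁| + |B₀B₁|` is at least the integral of `reachSum`, with equality for a convex one; the
shift by `π` in the second reach does not affect the integral.

It remains to compare the integrands pointwise. The traces contain the endpoints, so every reach sum
is at least `segmentReach`. If `θ` is an orientation of some viable configuration along the way, the
separation in direction `θ` is non-negative there, so the reach sum is also at least the reach of `𝔸
+ 𝔹`. Tightness says that `m` attains exactly these lower bounds (`CcwTight.reachSum_le`).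

Cauchy's formula enters as two inequalities, both obtained by averaging projections
(`integral_abs_dirCoord`). A closed curve covers its width in each direction at least twice, which
gives `integral_reach_le_curveLength_add`; the boundary of a convex set covers it no more than twice
(`eVariationOn_dirCoord_le`), which gives `TraversesBoundary.curveLength_le`. -/

/-! ### Projections onto a direction and their average -/

theorem dirCoord_smul (θ c : ℝ) (p : Plane) : dirCoord θ (c • p) = c * dirCoord θ p := by
  simp [dirCoord]; ring

theorem dirCoord_sub (θ : ℝ) (p q : Plane) :
    dirCoord θ (p - q) = dirCoord θ p - dirCoord θ q := by
  simp [dirCoord]; ring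

theorem dirCoord_add_pi (θ : ℝ) (p : Plane) : dirCoord (θ + Real.pi) p = -dirCoord θ p := by
  simp [dirCoord]; ring

theorem dirCoord_pi_add (θ : ℝ) (p : Plane) : dirCoord (Real.pi + θ) p = -dirCoord θ p := by
  rw [add_comm, dirCoord_add_pi]

theorem dirCoord_add_two_pi (θ : ℝ) (p : Plane) :
    dirCoord (θ + 2 * Real.pi) p = dirCoord θ p := by
  simp [dirCoord]

theorem continuous_dirCoord_uncurry : Continuous fun x : ℝ × Plane => dirCoord x.1 x.2 := by
  unfold dirCoord; fun_prop

theorem continuous_dirCoord (θ : ℝ) : Continuous (dirCoord θ) := by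
  unfold dirCoord; fun_prop

theorem continuous_dirCoord_left (p : Plane) : Continuous fun θ => dirCoord θ p := by
  unfold dirCoord; fun_prop

theorem isLinearMap_dirCoord (θ : ℝ) : IsLinearMap ℝ (dirCoord θ) :=
  ⟨dirCoord_add θ, fun c p => dirCoord_smul θ c p⟩

/-- Polar coordinates in the plane. -/
theorem exists_dirCoord_eq_norm_mul_cos (p : Plane) :
    ∃ α : ℝ, ∀ θ, dirCoord θ p = ‖p‖ * Real.cos (θ - α) := by
  let z : ℂ := ⟨p 0, p 1⟩
  have hz : ‖z‖ = ‖p‖ := by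
    rw [EuclideanSpace.norm_eq, Complex.norm_def, Complex.normSq_apply]
    simp [z, Fin.sum_univ_two, sq]
  refine ⟨z.arg, fun θ => ?_⟩
  have h0 : ‖z‖ * Real.cos z.arg = p 0 := Complex.norm_mul_cos_arg z
  have h1 : ‖z‖ * Real.sin z.arg = p 1 := Complex.norm_mul_sin_arg z
  rw [dirCoord, ← hz, Real.cos_sub, ← h0, ← h1]
  ring

theorem abs_dirCoord_le (θ : ℝ) (p : Plane) : |dirCoord θ p| ≤ ‖p‖ := by
  obtain ⟨α, h⟩ := exists_dirCoord_eq_norm_mul_cos p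
  rw [h, abs_mul, abs_norm]
  exact mul_le_of_le_one_right (norm_nonneg _) (Real.abs_cos_le_one _)

theorem integral_abs_cos (a : ℝ) : ∫ θ in a..a + Real.pi, |Real.cos θ| = 2 := by
  have hper : Function.Periodic (fun θ => |Real.cos θ|) Real.pi := fun θ => by simp
  -- The period `π` allows the interval to be moved to `[-π/2, π/2]`, where the cosine is
  -- non-negative.
  rw [hper.intervalIntegral_add_eq a (-(Real.pi / 2)),
    intervalIntegral.integral_congr (g := Real.cos)]
  · rw [integral_cos, Real.sin_neg, show -(Real.pi / 2) + Real.pi = Real.pi / 2 by ring,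
      Real.sin_pi_div_two]
    norm_num
  · intro θ hθ
    rw [Set.uIcc_of_le (by linarith [Real.pi_pos])] at hθ
    exact abs_of_nonneg (Real.cos_nonneg_of_mem_Icc ⟨hθ.1, by linarith [hθ.2]⟩)

/-- Over a half turn of directions, the length of the projection of a vector integrates to twice
its norm. -/
theorem integral_abs_dirCoord (a : ℝ) (p : Plane) :
    ∫ θ in a..a + Real.pi, |dirCoord θ p| = 2 * ‖p‖ := by
  obtain ⟨α, h⟩ := exists_dirCoord_eq_norm_mul_cos p
  simp_rw [h, abs_mul, abs_norm]
  rw [intervalIntegral.integral_const_mul,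
    intervalIntegral.integral_comp_sub_right (fun θ => |Real.cos θ|),
    show a + Real.pi - α = a - α + Real.pi by ring, integral_abs_cos, mul_comm]

/-! ### The reach as a support function -/

theorem le_reach {S : Set Plane} (hS : Bornology.IsBounded S) (θ : ℝ) {p : Plane} (hp : p ∈ S) :
    dirCoord θ p ≤ reach S θ :=
  le_csSup (bddAbove_dirCoord hS θ) ⟨p, hp, rfl⟩

theorem reach_le {S : Set Plane} (hS : S.Nonempty) {θ c : ℝ} (h : ∀ p ∈ S, dirCoord θ p ≤ c) :
    reach S θ ≤ c :=
  csSup_le (hS.image _) (by rintro _ ⟨p, hp, rfl⟩; exact h p hp)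

theorem reach_mono {S T : Set Plane} (hS : S.Nonempty) (hT : Bornology.IsBounded T) (h : S ⊆ T)
    (θ : ℝ) : reach S θ ≤ reach T θ :=
  reach_le hS fun _ hp => le_reach hT θ (h hp)

theorem reach_add_le {S T : Set Plane} (hS : S.Nonempty) (hT : T.Nonempty)
    (bS : Bornology.IsBounded S) (bT : Bornology.IsBounded T) (θ : ℝ) :
    reach (S + T) θ ≤ reach S θ + reach T θ := by
  refine reach_le (hS.add hT) ?_
  rintro _ ⟨p, hp, q, hq, rfl⟩
  rw [dirCoord_add]
  exact add_le_add (le_reach bS θ hp) (le_reach bT θ hq)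

theorem reach_convexHull {S : Set Plane} (hS : S.Nonempty) (bS : Bornology.IsBounded S) (θ : ℝ) :
    reach (convexHull ℝ S) θ = reach S θ := by
  refine le_antisymm (reach_le hS.convexHull fun p hp => ?_)
    (reach_mono hS (isBounded_convexHull.2 bS) (subset_convexHull ℝ S) θ)
  have : convexHull ℝ S ⊆ {p | dirCoord θ p ≤ reach S θ} :=
    convexHull_min (fun p hp => le_reach bS θ hp)
      (convex_halfSpace_le (isLinearMap_dirCoord θ) _)
  exact this hp

theorem reach_closure {S : Set Plane} (hS : S.Nonempty) (bS : Bornology.IsBounded S) (θ : ℝ) :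
    reach (closure S) θ = reach S θ := by
  refine le_antisymm (reach_le hS.closure fun p hp => ?_)
    (reach_mono hS bS.closure subset_closure θ)
  have : closure S ⊆ {p | dirCoord θ p ≤ reach S θ} :=
    closure_minimal (fun p hp => le_reach bS θ hp)
      (isClosed_le (continuous_dirCoord θ) continuous_const)
  exact this hp

/-- A non-zero linear functional has no maximum at an interior point, so a maximizer over the
closure already lies on the frontier. -/
theorem reach_frontier {K : Set Plane} (hne : K.Nonempty) (hK : Bornology.IsBounded K) (θ : ℝ) :
    reach (frontier K) θ = reach K θ := by
  obtain ⟨p, hp, hmax⟩ :=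
    hK.isCompact_closure.exists_isMaxOn hne.closure (continuous_dirCoord θ).continuousOn
  have hpf : p ∈ frontier K := by
    refine ⟨hp, fun hi => ?_⟩
    let u : Plane := !₂[Real.cos θ, Real.sin θ]
    have hu : dirCoord θ u = 1 := by
      simp [dirCoord, u]
      nlinarith [Real.sin_sq_add_cos_sq θ]
    have hc : Filter.Tendsto (fun ε : ℝ => p + ε • u) (nhds 0) (nhds p) := by
      have : Continuous (fun ε : ℝ => p + ε • u) := by fun_prop
      simpa using this.tendsto 0
    have hev : ∀ᶠ ε : ℝ in nhds 0, p + ε • u ∈ K := hc (mem_interior_iff_mem_nhds.1 hi)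
    obtain ⟨ε, hε, hε'⟩ := ((hev.filter_mono nhdsWithin_le_nhds).and
      (self_mem_nhdsWithin (s := Set.Ioi (0 : ℝ)))).exists
    have h1 : dirCoord θ (p + ε • u) ≤ dirCoord θ p := hmax (subset_closure hε)
    rw [dirCoord_add, dirCoord_smul, hu] at h1
    linarith [show 0 < ε from hε']
  rw [← reach_closure hne hK]
  refine le_antisymm (reach_mono ⟨p, hpf⟩ hK.closure frontier_subset_closure θ) ?_
  exact (reach_le hne.closure fun q hq => hmax hq).trans
    (le_reach (hK.closure.subset frontier_subset_closure) θ hpf)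

theorem continuous_reach {K : Set Plane} (hne : K.Nonempty) (hK : Bornology.IsBounded K) :
    Continuous (reach K) := by
  -- On the compact closure, the reach is a supremum of a jointly continuous function, hence
  -- continuous.
  rw [← funext (reach_closure hne hK)]
  exact hK.isCompact_closure.continuous_sSup continuous_dirCoord_uncurry

theorem periodic_reach (S : Set Plane) : Function.Periodic (reach S) (2 * Real.pi) := by
  intro θ
  unfold reach
  rw [show dirCoord (θ + 2 * Real.pi) = dirCoord θ from funext (dirCoord_add_two_pi θ)]

/-- The width integrated over a half turn is the reach integrated over a full turn. -/
theorem integral_width {K : Set Plane} (hne : K.Nonempty) (hK : Bornology.IsBounded K) (a : ℝ) :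
    ∫ θ in a..a + Real.pi, (reach K θ + reach K (θ + Real.pi)) =
      ∫ θ in (0 : ℝ)..2 * Real.pi, reach K θ := by
  have hc := continuous_reach hne hK
  have hi : ∀ b c, IntervalIntegrable (reach K) MeasureTheory.volume b c :=
    fun b c => hc.intervalIntegrable b c
  have hc' : Continuous fun θ => reach K (θ + Real.pi) := by fun_prop
  rw [intervalIntegral.integral_add (hi _ _) (hc'.intervalIntegrable _ _),
    intervalIntegral.integral_comp_add_right,
    intervalIntegral.integral_add_adjacent_intervals (hi _ _) (hi _ _),
    show a + Real.pi + Real.pi = a + 2 * Real.pi by ring,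
    (periodic_reach K).intervalIntegral_add_eq a 0, zero_add]

/-! ### Lower bound for the length of an arbitrary path -/

/-- Crofton's formula for a polygonal line with edges `v i`. The start `a` is kept free so that the
half turn can later begin at the initial normal of a boundary curve. -/
theorem sum_norm_eq_integral (a : ℝ) (n : ℕ) (v : ℕ → Plane) :
    ∫ θ in a..a + Real.pi, ∑ i ∈ Finset.range n, |dirCoord θ (v i)| =
      2 * ∑ i ∈ Finset.range n, ‖v i‖ := by
  rw [intervalIntegral.integral_finsetSum
    fun i _ => (continuous_dirCoord_left (v i)).abs.intervalIntegrable _ _, Finset.mul_sum]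
  exact Finset.sum_congr rfl fun i _ => integral_abs_dirCoord a (v i)

/-- Twice the distance between two vertices of a closed polygonal line on the real line is at most
its length. -/
theorem two_mul_sub_le_sum_abs_sub (x : ℕ → ℝ) {n i j : ℕ} (hi : i ≤ n) (hj : j ≤ n) :
    2 * (x i - x j) ≤ (∑ k ∈ Finset.range n, |x (k + 1) - x k|) + |x n - x 0| := by
  -- The vertices `i ≤ j` cut the closed line into two arcs, one from `i` to `j` and one through the
  -- closing edge; each is at least `|x i - x j|` long.
  have key : ∀ i j, i ≤ j → j ≤ n →
      2 * |x i - x j| ≤ (∑ k ∈ Finset.range n, |x (k + 1) - x k|) + |x n - x 0| := by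
    intro i j hij hj
    have h1 := dist_le_Ico_sum_dist x (Nat.zero_le i)
    have h2 := dist_le_Ico_sum_dist x hij
    have h3 := dist_le_Ico_sum_dist x hj
    have h4 := Finset.sum_Ico_consecutive (fun k => dist (x k) (x (k + 1))) (Nat.zero_le i) hij
    have h5 := Finset.sum_Ico_consecutive (fun k => dist (x k) (x (k + 1)))
      (Nat.zero_le j) hj
    rw [Finset.range_eq_Ico]
    have h6 : ∑ k ∈ Finset.Ico 0 n, |x (k + 1) - x k| =
        ∑ k ∈ Finset.Ico 0 n, dist (x k) (x (k + 1)) :=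
      Finset.sum_congr rfl fun k _ => by rw [dist_comm, Real.dist_eq]
    rw [h6]
    rw [Real.dist_eq] at h1 h2 h3
    have h7 : |x i - x j| ≤ |x 0 - x i| + |x j - x n| + |x n - x 0| := by
      have := abs_add_three (x i - x 0) (x 0 - x n) (x n - x j)
      rw [show x i - x 0 + (x 0 - x n) + (x n - x j) = x i - x j by ring,
        abs_sub_comm (x i) (x 0), abs_sub_comm (x 0) (x n), abs_sub_comm (x n) (x j)] at this
      linarith
    linarith
  rcases le_total i j with h | h
  · linarith [key i j h hj, le_abs_self (x i - x j)]
  · linarith [key j i h hi, neg_le_abs (x j - x i)]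

/-- Uniform continuity makes the vertices of an inscribed polygonal line come within `ε` of every
point of the path, so that its width approximates that of the trace. -/
theorem exists_monotone_fine_partition {P Q : Plane} (γ : Path P Q) {ε : ℝ} (hε : 0 < ε) :
    ∃ (n : ℕ) (u : ℕ → unitInterval), Monotone u ∧ u 0 = 0 ∧ u n = 1 ∧
      ∀ t, ∃ k ≤ n, dist (γ t) (γ (u k)) < ε := by
  obtain ⟨δ, hδ, hγ⟩ := Metric.uniformContinuous_iff.1
    (CompactSpace.uniformContinuous_of_continuous γ.continuous) ε hε
  obtain ⟨n, hn⟩ := exists_nat_one_div_lt hδ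
  have hn0 : (0 : ℝ) < n + 1 := by positivity
  -- Equal steps of length `1 / (n + 1) < δ`; the projection sends all later indices to `1`, which
  -- keeps the sequence monotone on all of `ℕ`.
  refine ⟨n + 1, fun k => Set.projIcc 0 1 zero_le_one ((k : ℝ) / (n + 1)), ?_, ?_, ?_, ?_⟩
  · intro i j hij
    apply Set.monotone_projIcc
    gcongr
  · simp
  · push_cast
    rw [div_self hn0.ne']
    exact Set.projIcc_right zero_le_one
  · intro t
    have h0 : 0 ≤ (t : ℝ) * (n + 1) := mul_nonneg t.2.1 hn0.le
    have hle := Nat.floor_le h0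
    have hlt := Nat.lt_floor_add_one ((t : ℝ) * (n + 1))
    have ht1 : (t : ℝ) * (n + 1) ≤ n + 1 := mul_le_of_le_one_left hn0.le t.2.2
    refine ⟨⌊(t : ℝ) * (n + 1)⌋₊, ?_, hγ ?_⟩
    · exact Nat.floor_le_of_le (by push_cast; exact ht1)
    · have hm : ((⌊(t : ℝ) * (n + 1)⌋₊ : ℝ) / (n + 1)) ∈ Set.Icc (0 : ℝ) 1 :=
        ⟨by positivity, by rw [div_le_one hn0]; linarith⟩
      simp only [Set.projIcc_of_mem zero_le_one hm]
      rw [Subtype.dist_eq, Real.dist_eq]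
      refine lt_of_le_of_lt ?_ hn
      rw [abs_le]
      constructor
      · rw [neg_le_sub_iff_le_add]
        have : (⌊(t : ℝ) * (n + 1)⌋₊ : ℝ) / (n + 1) ≤ t := by rwa [div_le_iff₀ hn0]
        have : 0 < 1 / ((n : ℝ) + 1) := by positivity
        linarith
      · rw [sub_le_iff_le_add, ← add_div, le_div_iff₀ hn0]
        linarith

/-- The closed curve that consists of a path and the segment between its endpoints is at least as
long as the boundary of the convex hull of the path. -/
theorem integral_reach_le_curveLength_add {P Q : Plane} (γ : Path P Q) :
    ENNReal.ofReal (∫ θ in (0 : ℝ)..2 * Real.pi, reach (Set.range γ) θ) ≤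
      curveLength γ + edist P Q := by
  have hK : IsCompact (Set.range γ) := isCompact_range γ.continuous
  have hne : (Set.range γ).Nonempty := Set.range_nonempty γ
  by_cases htop : curveLength γ = ⊤
  · simp [htop]
  have hfin : curveLength γ + edist P Q ≠ ⊤ := ENNReal.add_ne_top.2 ⟨htop, edist_ne_top _ _⟩
  rw [ENNReal.ofReal_le_iff_le_toReal hfin, ENNReal.toReal_add htop (edist_ne_top _ _),
    ← dist_edist]
  refine le_of_forall_pos_le_add fun η hη => ?_
  have hπ := Real.pi_pos
  -- The pointwise error `4 * ε` below integrates over a half turn to `4πε = 2η`, which is `η` after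
  -- halving.
  obtain ⟨n, u, hu, hu0, hu1, hfine⟩ :=
    exists_monotone_fine_partition γ (ε := η / (2 * Real.pi)) (by positivity)
  set ε := η / (2 * Real.pi) with hε
  set L : ℝ := ∑ i ∈ Finset.range n, ‖γ (u (i + 1)) - γ (u i)‖ with hL
  have hLle : L ≤ (curveLength γ).toReal := by
    rw [← ENNReal.ofReal_le_iff_le_toReal htop, hL,
      ENNReal.ofReal_sum_of_nonneg fun _ _ => norm_nonneg _]
    refine le_trans (le_of_eq ?_) (eVariationOn.sum_le (f := γ) (n := n) hu fun i => Set.mem_univ _)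
    exact Finset.sum_congr rfl fun i _ => by rw [edist_dist, dist_eq_norm]
  -- The width is attained by two points of the path. Moving each to a nearby vertex costs at most
  -- `ε`, hence `4 * ε` after doubling.
  have hpt : ∀ θ, 2 * (reach (Set.range γ) θ + reach (Set.range γ) (θ + Real.pi)) ≤
      (∑ i ∈ Finset.range n, |dirCoord θ (γ (u (i + 1)) - γ (u i))|) + |dirCoord θ (Q - P)|
        + 4 * ε := by
    intro θ
    have hp : ∀ s t, 2 * (dirCoord θ (γ s) - dirCoord θ (γ t)) ≤
        (∑ i ∈ Finset.range n, |dirCoord θ (γ (u (i + 1)) - γ (u i))|) + |dirCoord θ (Q - P)|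
          + 4 * ε := by
      intro s t
      obtain ⟨i, hi, hsi⟩ := hfine s
      obtain ⟨j, hj, htj⟩ := hfine t
      have h := two_mul_sub_le_sum_abs_sub (fun k => dirCoord θ (γ (u k))) hi hj
      simp only [hu0, hu1, γ.source, γ.target, ← dirCoord_sub] at h
      have h1 := (abs_le.1 ((abs_dirCoord_le θ (γ s - γ (u i))))).2
      have h2 := (abs_le.1 ((abs_dirCoord_le θ (γ t - γ (u j))))).1
      rw [← dist_eq_norm] at h1 h2
      simp only [dirCoord_sub] at h h1 h2 ⊢
      linarith
    obtain ⟨_, ⟨s, rfl⟩, hs⟩ := hK.exists_isMaxOn hne (continuous_dirCoord θ).continuousOn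
    obtain ⟨_, ⟨t, rfl⟩, ht⟩ := hK.exists_isMaxOn hne (continuous_dirCoord (θ + Real.pi)).continuousOn
    have hs' : reach (Set.range γ) θ ≤ dirCoord θ (γ s) := reach_le hne fun q hq => hs hq
    have ht' : reach (Set.range γ) (θ + Real.pi) ≤ dirCoord (θ + Real.pi) (γ t) :=
      reach_le hne fun q hq => ht hq
    rw [dirCoord_add_pi] at ht'
    linarith [hp s t]
  have hr := continuous_reach hne hK.isBounded
  have hcs : Continuous fun θ =>
      ∑ i ∈ Finset.range n, |dirCoord θ (γ (u (i + 1)) - γ (u i))| :=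
    continuous_finsetSum _ fun i _ => (continuous_dirCoord_left _).abs
  have hcd : Continuous fun θ => |dirCoord θ (Q - P)| := (continuous_dirCoord_left _).abs
  have hint := intervalIntegral.integral_mono_on (μ := MeasureTheory.volume)
    (show (0 : ℝ) ≤ 0 + Real.pi by linarith)
    (Continuous.intervalIntegrable (by fun_prop) _ _)
    (Continuous.intervalIntegrable (by fun_prop) _ _)
    (fun θ _ => hpt θ)
  rw [intervalIntegral.integral_const_mul, integral_width hne hK.isBounded,
    intervalIntegral.integral_add (Continuous.intervalIntegrable (by fun_prop) _ _)
      (continuous_const.intervalIntegrable _ _),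
    intervalIntegral.integral_add (hcs.intervalIntegrable _ _) (hcd.intervalIntegrable _ _),
    sum_norm_eq_integral 0 n fun i => γ (u (i + 1)) - γ (u i), integral_abs_dirCoord,
    intervalIntegral.integral_const, smul_eq_mul] at hint
  have hη' : (0 + Real.pi - 0) * (4 * ε) = 2 * η := by
    rw [hε]; field_simp; ring
  rw [hη', ← hL, ← dist_eq_norm, dist_comm Q P] at hint
  linarith

/-! ### Upper bound for the length of a convex boundary -/

/-- The unit vector in direction `θ`, scaled by `sin (β - α)`, is a combination of those in
directions `α` and `β`. This carries sign information from two support lines over to `θ`. -/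
theorem sin_sub_mul_dirCoord (α β θ : ℝ) (p : Plane) :
    Real.sin (β - α) * dirCoord θ p =
      Real.sin (β - θ) * dirCoord α p + Real.sin (θ - α) * dirCoord β p := by
  simp only [dirCoord, Real.sin_sub]
  ring

theorem eVariationOn_neg (f : unitInterval → ℝ) (s : Set unitInterval) :
    eVariationOn (fun t => -f t) s = eVariationOn f s := by
  simp only [eVariationOn, edist_neg_neg]

/-- A vector between two points that lie, in this order, on lines of support with outward normal
directions in `[θ - π, θ]` points forward in direction `θ`. -/
theorem dirCoord_nonneg_of_support {α β θ : ℝ} {v : Plane} (hα : θ - Real.pi ≤ α) (hαβ : α ≤ β)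
    (hβ : β ≤ θ) (h1 : dirCoord α v ≤ 0) (h2 : 0 ≤ dirCoord β v)
    (h3 : α = β → 0 ≤ dirCoord (β + Real.pi / 2) v) : 0 ≤ dirCoord θ v := by
  rcases hαβ.eq_or_lt with rfl | hlt
  -- Here `v` lies along the common support line, so only its component along that line contributes.
  · have h := sin_sub_mul_dirCoord α (α + Real.pi / 2) θ v
    rw [add_sub_cancel_left, Real.sin_pi_div_two, one_mul, le_antisymm h1 h2, mul_zero,
      zero_add] at h
    rw [h]
    exact mul_nonneg (Real.sin_nonneg_of_nonneg_of_le_pi (by linarith) (by linarith)) (h3 rfl)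
  -- A difference of exactly `π` makes the sine vanish, but it forces `β = θ`.
  · rcases (show β - α ≤ Real.pi by linarith).eq_or_lt with heq | hlt'
    · have : β = θ := by linarith
      exact this ▸ h2
    · have h := sin_sub_mul_dirCoord α β θ v
      have hs : 0 < Real.sin (β - α) := Real.sin_pos_of_pos_of_lt_pi (by linarith) hlt'
      have k1 : Real.sin (β - θ) ≤ 0 :=
        Real.sin_nonpos_of_nonpos_of_neg_pi_le (by linarith) (by linarith)
      have k2 : 0 ≤ Real.sin (θ - α) :=
        Real.sin_nonneg_of_nonneg_of_le_pi (by linarith) (by linarith)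
      refine nonneg_of_mul_nonneg_right ?_ hs
      rw [h]
      exact add_nonneg (mul_nonneg_of_nonpos_of_nonpos k1 h1) (mul_nonneg k2 h2)

/-- A curve that traverses the boundary of a convex set moves monotonically in direction `θ` while
the outward normal turns from `θ - π` to `θ`. -/
theorem monotoneOn_dirCoord_of_support {K : Set Plane} {γ : unitInterval → Plane}
    {ν : unitInterval → ℝ} (hν : Monotone ν)
    (hsupp : ∀ t, γ t ∈ K ∧ ∀ x ∈ K, dirCoord (ν t) x ≤ dirCoord (ν t) (γ t))
    (hfwd : ∀ s t, s ≤ t → ν s = ν t →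
      dirCoord (ν t + Real.pi / 2) (γ s) ≤ dirCoord (ν t + Real.pi / 2) (γ t))
    {θ : ℝ} {a b : unitInterval} (ha : θ - Real.pi ≤ ν a) (hb : ν b ≤ θ) :
    MonotoneOn (fun t => dirCoord θ (γ t)) (Set.Icc a b) := by
  intro s hs t ht hst
  have h := dirCoord_nonneg_of_support (v := γ t - γ s) (ha.trans (hν hs.1)) (hν hst)
    ((hν ht.2).trans hb)
    (by rw [dirCoord_sub]; linarith [(hsupp s).2 _ (hsupp t).1])
    (by rw [dirCoord_sub]; linarith [(hsupp t).2 _ (hsupp s).1])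
    (fun h => by rw [dirCoord_sub]; linarith [hfwd s t hst h])
  rw [dirCoord_sub] at h
  simpa using h

theorem MonotoneOn.eVariationOn_Icc {f : unitInterval → ℝ} {a b : unitInterval} (hab : a ≤ b)
    (hf : MonotoneOn f (Set.Icc a b)) :
    eVariationOn f (Set.Icc a b) = ENNReal.ofReal (f b - f a) := by
  simpa using hf.eVariationOn_eq (Set.left_mem_Icc.2 hab) (Set.right_mem_Icc.2 hab)

/-- The boundary of a bounded convex set crosses every direction twice: its variation in direction
`θ` is at most twice the width. -/
theorem eVariationOn_dirCoord_le {K : Set Plane} (hK : Bornology.IsBounded K) {P : Plane} (γ : Path P P)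
    {ν : unitInterval → ℝ} (hνc : Continuous ν) (hν : Monotone ν) (hν1 : ν 1 = ν 0 + 2 * Real.pi)
    (hsupp : ∀ t, γ t ∈ K ∧ ∀ x ∈ K, dirCoord (ν t) x ≤ dirCoord (ν t) (γ t))
    (hfwd : ∀ s t, s ≤ t → ν s = ν t →
      dirCoord (ν t + Real.pi / 2) (γ s) ≤ dirCoord (ν t + Real.pi / 2) (γ t))
    {θ : ℝ} (hθ : θ ∈ Set.Icc (ν 0) (ν 0 + Real.pi)) :
    eVariationOn (fun t => dirCoord θ (γ t)) Set.univ ≤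
      ENNReal.ofReal (2 * (reach K θ + reach K (θ + Real.pi))) := by
  have hπ := Real.pi_pos
  have ivt : ∀ φ ∈ Set.Icc (ν 0) (ν 1), ∃ t, ν t = φ := fun φ hφ =>
    mem_range_of_exists_le_of_exists_ge hνc ⟨0, hφ.1⟩ ⟨1, hφ.2⟩
  -- Cutting where the normal equals `θ` and `θ + π` leaves three monotone pieces: forward,
  -- backward, forward. The last is treated in direction `θ + 2π`, since its normals lie in `[θ + π,
  -- θ + 2π]`.
  obtain ⟨a, ha⟩ := ivt θ ⟨hθ.1, by linarith [hθ.2]⟩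
  obtain ⟨b, hb⟩ := ivt (θ + Real.pi) ⟨by linarith [hθ.1], by linarith [hθ.2]⟩
  have hab : a ≤ b := le_of_lt (hν.reflect_lt (by linarith))
  have m1 : MonotoneOn (fun t => dirCoord θ (γ t)) (Set.Icc 0 a) :=
    monotoneOn_dirCoord_of_support hν hsupp hfwd (by linarith [hθ.2]) ha.le
  have m2 : MonotoneOn (fun t => -dirCoord θ (γ t)) (Set.Icc a b) := by
    simp only [← dirCoord_add_pi]
    exact monotoneOn_dirCoord_of_support hν hsupp hfwd (by linarith) hb.le
  have m3 : MonotoneOn (fun t => dirCoord θ (γ t)) (Set.Icc b 1) := by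
    simp only [← fun t => dirCoord_add_two_pi θ (γ t)]
    exact monotoneOn_dirCoord_of_support hν hsupp hfwd (by linarith) (by linarith [hθ.1])
  have hu : (Set.univ : Set unitInterval) = Set.Icc 0 1 := by
    ext t; simp [unitInterval.le_one']
  have e1 := eVariationOn.Icc_add_Icc (fun t => dirCoord θ (γ t)) (s := Set.univ)
    (unitInterval.nonneg' (t := a)) hab (Set.mem_univ _)
  have e2 := eVariationOn.Icc_add_Icc (fun t => dirCoord θ (γ t)) (s := Set.univ)
    (unitInterval.nonneg' (t := b)) (unitInterval.le_one' (t := b)) (Set.mem_univ _)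
  simp only [Set.univ_inter] at e1 e2
  have d1 := m1 (Set.left_mem_Icc.2 unitInterval.nonneg') (Set.right_mem_Icc.2 unitInterval.nonneg')
    unitInterval.nonneg'
  have d2 := m2 (Set.left_mem_Icc.2 hab) (Set.right_mem_Icc.2 hab) hab
  have d3 := m3 (Set.left_mem_Icc.2 unitInterval.le_one')
    (Set.right_mem_Icc.2 unitInterval.le_one') unitInterval.le_one'
  have v2 := m2.eVariationOn_Icc hab
  rw [eVariationOn_neg (fun t => dirCoord θ (γ t))] at v2
  simp only at d1 d2 d3
  rw [hu, ← e2, ← e1, m1.eVariationOn_Icc unitInterval.nonneg',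
    m3.eVariationOn_Icc unitInterval.le_one', v2,
    ← ENNReal.ofReal_add (by linarith) (by linarith),
    ← ENNReal.ofReal_add (by linarith) (by linarith)]
  apply ENNReal.ofReal_le_ofReal
  have r1 := le_reach hK θ (hsupp a).1
  have r2 := le_reach hK (θ + Real.pi) (hsupp b).1
  rw [dirCoord_add_pi] at r2
  -- The curve is closed, so the values at its two ends cancel, and the variation is twice the
  -- difference between the values at `a` and `b`.
  rw [γ.source, γ.target]
  linarith

/-- The boundary of a bounded convex set is at most as long as the integral of the reach. -/
theorem TraversesBoundary.curveLength_le {K : Set Plane} (hK : Bornology.IsBounded K) {P : Plane}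
    {γ : Path P P} (h : TraversesBoundary K γ) :
    curveLength γ ≤ ENNReal.ofReal (∫ θ in (0 : ℝ)..2 * Real.pi, reach K θ) := by
  obtain ⟨ν, hνc, hν, hν1, hsupp, hfwd⟩ := h
  refine iSup_le ?_
  rintro ⟨n, u, hu, -⟩
  have hπ := Real.pi_pos
  have hL : ∑ i ∈ Finset.range n, edist (γ (u (i + 1))) (γ (u i)) =
      ENNReal.ofReal (∑ i ∈ Finset.range n, ‖γ (u (i + 1)) - γ (u i)‖) := by
    rw [ENNReal.ofReal_sum_of_nonneg fun _ _ => norm_nonneg _]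
    exact Finset.sum_congr rfl fun i _ => by rw [edist_dist, dist_eq_norm]
  refine hL.trans_le (ENNReal.ofReal_le_ofReal ?_)
  -- One half turn of directions suffices; it starts at `ν 0`, where `eVariationOn_dirCoord_le`
  -- applies.
  have hpt : ∀ θ ∈ Set.Icc (ν 0) (ν 0 + Real.pi),
      ∑ i ∈ Finset.range n, |dirCoord θ (γ (u (i + 1)) - γ (u i))| ≤
        2 * (reach K θ + reach K (θ + Real.pi)) := by
    intro θ hθ
    have hw : 0 ≤ 2 * (reach K θ + reach K (θ + Real.pi)) := by
      have r1 := le_reach hK θ (hsupp 0).1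
      have r2 := le_reach hK (θ + Real.pi) (hsupp 0).1
      rw [dirCoord_add_pi] at r2
      linarith
    rw [← ENNReal.ofReal_le_ofReal_iff hw, ENNReal.ofReal_sum_of_nonneg fun _ _ => abs_nonneg _]
    refine le_trans (le_of_eq (Finset.sum_congr rfl fun i _ => ?_))
      ((eVariationOn.sum_le (f := fun t => dirCoord θ (γ t)) (n := n) hu
        fun i => Set.mem_univ _).trans
        (eVariationOn_dirCoord_le hK γ hνc hν hν1 hsupp hfwd hθ))
    rw [edist_dist, Real.dist_eq, dirCoord_sub]
  have hr := continuous_reach ⟨_, (hsupp 0).1⟩ hK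
  have hcs : Continuous fun θ =>
      ∑ i ∈ Finset.range n, |dirCoord θ (γ (u (i + 1)) - γ (u i))| :=
    continuous_finsetSum _ fun i _ => (continuous_dirCoord_left _).abs
  have hint := intervalIntegral.integral_mono_on (μ := MeasureTheory.volume)
    (show ν 0 ≤ ν 0 + Real.pi by linarith) (hcs.intervalIntegrable _ _)
    (Continuous.intervalIntegrable (by fun_prop) _ _) hpt
  rw [intervalIntegral.integral_const_mul, integral_width ⟨_, (hsupp 0).1⟩ hK,
    sum_norm_eq_integral (ν 0) n fun i => γ (u (i + 1)) - γ (u i)] at hint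
  linarith

/-! ### Reach and length of a motion -/

namespace Motion

variable {Z₀ Z₁ : Plane} (ξ : Motion Z₀ Z₁)

theorem isBounded_trace : Bornology.IsBounded ξ.trace :=
  (isCompact_range ξ.path.continuous).isBounded

theorem trace_nonempty : ξ.trace.Nonempty := Set.range_nonempty ξ.path

theorem path_mem_trace (t : unitInterval) : ξ.path t ∈ ξ.trace := Set.mem_range_self t

theorem reach_hullBoundary (θ : ℝ) : reach ξ.hullBoundary θ = reach ξ.trace θ := by
  rw [hullBoundary, reach_frontier ξ.trace_nonempty.convexHull
      (isBounded_convexHull.2 ξ.isBounded_trace),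
    reach_convexHull ξ.trace_nonempty ξ.isBounded_trace]

theorem reach_segment_le (θ : ℝ) : reach (segment ℝ Z₀ Z₁) θ ≤ reach ξ.trace θ := by
  rw [← reach_convexHull ξ.trace_nonempty ξ.isBounded_trace]
  refine reach_mono ⟨Z₀, left_mem_segment ℝ Z₀ Z₁⟩ (isBounded_convexHull.2 ξ.isBounded_trace) ?_ θ
  exact segment_subset_convexHull ⟨0, ξ.path.source⟩ ⟨1, ξ.path.target⟩

/-- The reach may be negative in some directions if the origin is outside the hull, but its integral
is that of the width. -/
theorem integral_reach_nonneg :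
    0 ≤ ∫ θ in (0 : ℝ)..2 * Real.pi, reach ξ.trace θ := by
  rw [← integral_width ξ.trace_nonempty ξ.isBounded_trace 0]
  refine intervalIntegral.integral_nonneg (by linarith [Real.pi_pos]) fun θ _ => ?_
  have r1 := le_reach ξ.isBounded_trace θ (ξ.path_mem_trace 0)
  have r2 := le_reach ξ.isBounded_trace (θ + Real.pi) (ξ.path_mem_trace 0)
  rw [dirCoord_add_pi] at r2
  linarith

theorem IsConvex.length_add_edist_le {ξ : Motion Z₀ Z₁} (h : ξ.IsConvex) :
    ξ.length + edist Z₀ Z₁ ≤ ENNReal.ofReal (∫ θ in (0 : ℝ)..2 * Real.pi, reach ξ.trace θ) := by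
  obtain ⟨P, γ, hγ, hlen⟩ := h
  rw [← hlen]
  refine (hγ.curveLength_le (isBounded_convexHull.2 ξ.isBounded_trace)).trans_eq ?_
  simp_rw [reach_convexHull ξ.trace_nonempty ξ.isBounded_trace]

end Motion

/-! ### Reach sums of co-motions -/

namespace CoMotion

variable {A₀ B₀ A₁ B₁ : Plane}

/-- The sum of the reach of the first trace in direction `θ` and of the second in direction
`π + θ`. -/
noncomputable def reachSum (m : CoMotion A₀ B₀ A₁ B₁) (θ : ℝ) : ℝ :=
  reach m.motionA.trace θ + reach m.motionB.trace (Real.pi + θ)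

theorem continuous_reachSum (m : CoMotion A₀ B₀ A₁ B₁) : Continuous m.reachSum := by
  have h1 := continuous_reach m.motionA.trace_nonempty m.motionA.isBounded_trace
  have h2 := continuous_reach m.motionB.trace_nonempty m.motionB.isBounded_trace
  unfold reachSum
  fun_prop

theorem integral_reachSum (m : CoMotion A₀ B₀ A₁ B₁) :
    ∫ θ in (0 : ℝ)..2 * Real.pi, m.reachSum θ =
      (∫ θ in (0 : ℝ)..2 * Real.pi, reach m.motionA.trace θ) +
        ∫ θ in (0 : ℝ)..2 * Real.pi, reach m.motionB.trace θ := by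
  have h1 := continuous_reach m.motionA.trace_nonempty m.motionA.isBounded_trace
  have h2 := continuous_reach m.motionB.trace_nonempty m.motionB.isBounded_trace
  have h3 : Continuous fun θ => reach m.motionB.trace (Real.pi + θ) := by fun_prop
  unfold reachSum
  rw [intervalIntegral.integral_add (h1.intervalIntegrable _ _) (h3.intervalIntegrable _ _),
    intervalIntegral.integral_comp_add_left, add_zero,
    (periodic_reach m.motionB.trace).intervalIntegral_add_eq Real.pi 0, zero_add]

theorem segmentReach_le_reachSum (m : CoMotion A₀ B₀ A₁ B₁) (θ : ℝ) :
    segmentReach A₀ B₀ A₁ B₁ θ ≤ m.reachSum θ :=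
  add_le_add (m.motionA.reach_segment_le θ) (m.motionB.reach_segment_le _)

/-- If a collision-free co-motion realizes the orientation `θ`, its reach sum in direction `θ` is at
least the reach of the Minkowski sum of the robots. -/
theorem CollisionFree.reach_add_le_reachSum {𝔸 𝔹 : Set Plane} (h𝔸 : IsCCSRobot 𝔸)
    (h𝔹 : IsCCSRobot 𝔹) {m : CoMotion A₀ B₀ A₁ B₁} (hm : m.CollisionFree 𝔸 𝔹) {θ : ℝ}
    (hθ : θ ∈ m.orientationRange 𝔸 𝔹) : reach (𝔸 + 𝔹) θ ≤ m.reachSum θ := by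
  obtain ⟨t, ht⟩ := hθ
  obtain ⟨φ, hφ⟩ := hm t
  -- Viability gives non-negative separation in some direction, hence also in the maximizing
  -- direction `θ`.
  have hsep := hφ.trans (ht φ)
  rw [separation, reach_placement h𝔸, reach_placement h𝔹] at hsep
  have h1 := reach_add_le h𝔸.nonempty h𝔹.nonempty h𝔸.bounded h𝔹.bounded θ
  have h2 := le_reach m.motionA.isBounded_trace θ (m.motionA.path_mem_trace t)
  have h3 := le_reach m.motionB.isBounded_trace (Real.pi + θ)
    (m.motionB.path_mem_trace t)
  rw [dirCoord_pi_add] at h3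
  unfold reachSum
  linarith

/-- A counter-clockwise tight co-motion has the least reach sum among the collision-free net
counter-clockwise co-motions. -/
theorem CcwTight.reachSum_le {𝔸 𝔹 : Set Plane} (h𝔸 : IsCCSRobot 𝔸) (h𝔹 : IsCCSRobot 𝔹)
    {θ₀ θ₁ : ℝ} {m m' : CoMotion A₀ B₀ A₁ B₁} (h : m.CcwTight 𝔸 𝔹 θ₀ θ₁)
    (hfree : m'.CollisionFree 𝔸 𝔹) (hccw : m'.NetCcw 𝔸 𝔹 θ₀ θ₁) (θ : ℝ) :
    m.reachSum θ ≤ m'.reachSum θ := by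
  obtain ⟨hin, hout⟩ := h
  simp only [Motion.reach_hullBoundary] at hin hout
  by_cases hθ : θ ∈ ccwArc θ₀ θ₁
  · exact (hin θ hθ).trans_le (max_le (m'.segmentReach_le_reachSum θ)
      (hfree.reach_add_le_reachSum h𝔸 h𝔹 (hccw hθ)))
  · exact (hout θ hθ).trans_le (m'.segmentReach_le_reachSum θ)

theorem IsConvex.length_add_edist_le {m : CoMotion A₀ B₀ A₁ B₁} (h : m.IsConvex) :
    m.length + (edist A₀ A₁ + edist B₀ B₁) ≤
      ENNReal.ofReal (∫ θ in (0 : ℝ)..2 * Real.pi, m.reachSum θ) := by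
  rw [integral_reachSum, ENNReal.ofReal_add m.motionA.integral_reach_nonneg
    m.motionB.integral_reach_nonneg, length, add_add_add_comm]
  exact add_le_add h.1.length_add_edist_le h.2.length_add_edist_le

theorem integral_reachSum_le_length_add_edist (m : CoMotion A₀ B₀ A₁ B₁) :
    ENNReal.ofReal (∫ θ in (0 : ℝ)..2 * Real.pi, m.reachSum θ) ≤
      m.length + (edist A₀ A₁ + edist B₀ B₁) := by
  rw [integral_reachSum, ENNReal.ofReal_add m.motionA.integral_reach_nonneg
    m.motionB.integral_reach_nonneg, length, add_add_add_comm]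
  exact add_le_add (integral_reach_le_curveLength_add _) (integral_reach_le_curveLength_add _)

end CoMotion

theorem mainTheorem5 (𝔸 𝔹 : Set Plane) (h𝔸 : IsCCSRobot 𝔸) (h𝔹 : IsCCSRobot 𝔹)
    (A₀ B₀ A₁ B₁ : Plane) (θ₀ θ₁ : ℝ)
    (hθ₀ : IsOrientation 𝔸 𝔹 A₀ B₀ θ₀) (hθ₁ : IsOrientation 𝔸 𝔹 A₁ B₁ θ₁)
    (m : CoMotion A₀ B₀ A₁ B₁)
    (hfree : m.CollisionFree 𝔸 𝔹)
    (hccw : m.NetCcw 𝔸 𝔹 θ₀ θ₁)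
    (hconvex : m.IsConvex)
    (htight : m.CcwTight 𝔸 𝔹 θ₀ θ₁) :
    m.IsCcwOptimal 𝔸 𝔹 θ₀ θ₁ := by
  refine ⟨hfree, hccw, fun m' hfree' hccw' => ?_⟩
  -- Both co-motions have the same endpoints, so the finite endpoint distances can be added to both
  -- lengths and cancelled.
  have hfin : edist A₀ A₁ + edist B₀ B₁ ≠ ⊤ :=
    ENNReal.add_ne_top.2 ⟨edist_ne_top _ _, edist_ne_top _ _⟩
  refine (ENNReal.add_le_add_iff_right hfin).1 ?_
  refine hconvex.length_add_edist_le.trans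
    ((ENNReal.ofReal_le_ofReal ?_).trans m'.integral_reachSum_le_length_add_edist)
  exact intervalIntegral.integral_mono_on (by linarith [Real.pi_pos])
    (m.continuous_reachSum.intervalIntegrable _ _) (m'.continuous_reachSum.intervalIntegrable _ _)
    fun θ _ => htight.reachSum_le h𝔸 h𝔹 hfree' hccw' θ
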